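/- Let $m\ge 1$ be an integer and put $\mu_j=\binom{m+j}{m-j}$ for $0\le j\le m$ and $\mu_j=0$ for $j>m$. Consider words over the alphabet $\{a,b\}$, and let the valuation $h$ of a word be the sum of the valuations of its letters, where $h(a)=2m+1$ and $h(b)=-2$. A generalized Dyck word is a word $w$ with $h(w)=0$ all of whose left factors (prefixes) $w_1$ satisfy $h(w_1)\ge 0$; a word is factor-free if none of its proper factors is a nonempty generalized Dyck word. Let $U=U_{(2m+1)/2}$ be the language consisting of the empty word together with all words $w$ with $h(w)=0$ that have at least one left factor of negative valuation, all of whose left factors $w_1$ satisfy $h(w_1)>-2m$, and for which $a\,w\,b^m$ is factor-free. (Equivalently, $L_1=a\,U\,b^m$, where $L_1$ is the set of factor-free words of valuation $1$ all of whose nonempty proper left factors have valuation greater than $1$.) Let $u_n$ be the number of words of length $(2m+3)n$ in $U$. Then for every $n\ge 1$ $$u_n=\sum_{k=1}^n\binom{2n}{k-1}\frac{(k-1)!}{n!}\,B_{n,k}(1!\mu_1,2!\mu_2,\dots),$$ where $$B_{n,k}(x_1,x_2,\dots)=\sum\frac{n!}{\prod_{i\ge1} c_i!\,(i!)^{c_i}}\prod_{i\ge1}x_i^{c_i}$$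 is the partial Bell polynomial, the sum being over all integers $c_1,c_2,\dots\ge 0$ with $\sum_i c_i=k$ and $\sum_i i\,c_i=n$. Moreover, the generating function $\mathcal U(t)=\sum_{n\ge0}u_nt^n$ is the unique formal power series over $\mathbb{Q}$ that satisfies $$\mathcal U(t)=1+\sum_{j=1}^m\mu_j\,t^j\,\mathcal U(t)^{2j}.$$ -/

import Mathlib

namespace FactorFree

/-- The two-letter alphabet `{a, b}`. -/
inductive Letter where
  | a : Letter
  | b : Letter
  deriving DecidableEq

instance : Fintype Letter where
  elems := {Letter.a, Letter.b}
  complete := by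
    intro x
    cases x <;> simp

/-- The valuation of a letter: `h(a) = 2m + 1` and `h(b) = -2`. -/
def letterVal (m : ℕ) : Letter → ℤ
  | Letter.a => 2 * (m : ℤ) + 1
  | Letter.b => -2

/-- The total valuation of a word: the sum of the valuations of its letters. -/
def val (m : ℕ) (w : List Letter) : ℤ :=
  (w.map (letterVal m)).sum

/-- The generalized Dyck words: total valuation `0`, and every left factor (prefix) has
nonnegative valuation. -/
def dyckWords (m : ℕ) : Language Letter :=
  {w | val m w = 0 ∧ ∀ w₁ : List Letter, w₁ <+: w → 0 ≤ val m w₁}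

/-- A word is factor-free if it has no proper factor that is a nonempty generalized Dyck word.
(The empty word is a Dyck word and a factor of every word, so it has to be left aside.) -/
def IsFactorFree (m : ℕ) (w : List Letter) : Prop :=
  ∀ w₁ w' w₂ : List Letter, w = w₁ ++ w' ++ w₂ → ¬(w₁ = [] ∧ w₂ = []) → w' ≠ [] →
    w' ∉ dyckWords m

/-- The language `L_i`: the factor-free words of total valuation `i` all of whose nonempty proper
left factors have valuation greater than `i`. -/
def langL (m i : ℕ) : Language Letter :=
  {w | IsFactorFree m w ∧ val m w = i ∧
    ∀ w₁ : List Letter, w₁ <+: w → w₁ ≠ [] → w₁ ≠ w → (i : ℤ) < val m w₁}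

/-- The word `a w b^m`. -/
def wrap (m : ℕ) (w : List Letter) : List Letter :=
  Letter.a :: (w ++ List.replicate m Letter.b)

/-- The auxiliary language `U` of slope `(2m+1)/2`: the empty word together with all words `w` of
total valuation `0` that have at least one left factor of negative valuation, all of whose left
factors have valuation greater than `-2m`, and for which `a w b^m` is factor-free. Factor-freeness
is required of `a w b^m` and not only of `w`, because `U` is the language with `L_1 = a U b^m`
(see `mem_langL_one_iff`); for `m = 2` the word `babbabb` is factor-free but `a babbabb bb` is
not. -/
def auxLang (m : ℕ) : Language Letter :=
  {w | w = [] ∨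
    (IsFactorFree m (wrap m w) ∧ val m w = 0 ∧
      (∃ w₁ : List Letter, w₁ <+: w ∧ val m w₁ < 0) ∧
      ∀ w₁ : List Letter, w₁ <+: w → -2 * (m : ℤ) < val m w₁)}

theorem val_append (m : ℕ) (v w : List Letter) : val m (v ++ w) = val m v + val m w := by
  simp [val]

theorem val_cons (m : ℕ) (c : Letter) (w : List Letter) :
    val m (c :: w) = letterVal m c + val m w := by
  simp [val]

theorem val_replicate_b (m k : ℕ) : val m (List.replicate k Letter.b) = -2 * (k : ℤ) := by
  simp [val, letterVal, mul_comm]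

theorem val_eq_count (m : ℕ) (w : List Letter) :
    val m w = (2 * (m : ℤ) + 1) * (w.count Letter.a : ℤ) - 2 * (w.count Letter.b : ℤ) := by
  induction w with
  | nil => simp [val]
  | cons c w ih =>
    rw [val_cons, ih]
    cases c <;> simp [letterVal] <;> ring

theorem length_eq_count (w : List Letter) :
    w.length = w.count Letter.a + w.count Letter.b := by
  induction w with
  | nil => simp
  | cons c w ih => cases c <;> simp [ih] <;> omega

theorem isFactorFree_wrap_nil (m : ℕ) : IsFactorFree m (wrap m []) := by
  intro w₁ w' w₂ h _ hne hw'
  have h0 := hw'.1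
  have hc : w'.count Letter.a ≤ 1 := by
    have h1 : (wrap m []).count Letter.a = 1 := by
      simp [wrap, List.count_replicate]
    rw [h, List.count_append, List.count_append] at h1
    omega
  rw [val_eq_count] at h0
  have hl := length_eq_count w'
  have hpos := List.length_pos_of_ne_nil hne
  generalize w'.count Letter.a = x at *
  generalize w'.count Letter.b = y at *
  interval_cases x <;> push_cast at h0 <;> omega

theorem exists_wrap_of_mem (m : ℕ) (w : List Letter) (hw : w ∈ langL m 1) (j : ℕ) (hj : j ≤ m) :
    ∃ v, w = Letter.a :: (v ++ List.replicate j Letter.b) := by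
  obtain ⟨_, hv, hp⟩ := hw
  induction j with
  | zero =>
    cases w with
    | nil => simp [val] at hv
    | cons c t =>
      cases c with
      | a => exact ⟨t, by simp⟩
      | b =>
        exfalso
        by_cases ht : t = []
        · subst ht
          simp [val, letterVal] at hv
        · have := hp [Letter.b] ⟨t, by simp⟩ (by simp) (by simpa using Ne.symm ht)
          simp [val, letterVal] at this
  | succ j ih =>
    obtain ⟨v, rfl⟩ := ih (by omega)
    rw [val_cons, val_append, val_replicate_b] at hv
    simp only [letterVal] at hv
    rcases List.eq_nil_or_concat v with rfl | ⟨v', c, rfl⟩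
    · simp [val] at hv
      omega
    · cases c with
      | b => exact ⟨v', by simp [List.replicate_succ]⟩
      | a =>
        exfalso
        have h := hp (Letter.a :: v') ⟨[Letter.a] ++ List.replicate j Letter.b, by simp⟩
          (by simp) (by intro h; simpa using congrArg List.length h)
        have h1 : val m [Letter.a] = 2 * (m : ℤ) + 1 := by simp [val, letterVal]
        rw [List.concat_eq_append, val_append, h1] at hv
        rw [val_cons] at h
        simp only [letterVal] at h
        push_cast at h hv
        omega

/-- The factorization `L_1 = a U b^m` that determines `U`. -/
theorem mem_langL_one_iff (m : ℕ) (hm : 1 ≤ m) (w : List Letter) :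
    w ∈ langL m 1 ↔ ∃ v ∈ auxLang m, w = wrap m v := by
  constructor
  · intro hw
    obtain ⟨v, rfl⟩ := exists_wrap_of_mem m w hw m le_rfl
    refine ⟨v, ?_, rfl⟩
    obtain ⟨hf, hv, hp⟩ := hw
    have hv0 : val m v = 0 := by
      rw [val_cons, val_append, val_replicate_b] at hv
      simp only [letterVal] at hv
      push_cast at hv
      linarith
    by_cases hn : v = []
    · exact Or.inl hn
    refine Or.inr ⟨hf, hv0, ?_, ?_⟩
    · by_contra hcon
      push Not at hcon
      exact hf [Letter.a] v (List.replicate m Letter.b) (by simp) (by simp) hn ⟨hv0, hcon⟩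
    · rintro p ⟨q, rfl⟩
      have := hp (Letter.a :: p) ⟨q ++ List.replicate m Letter.b, by simp⟩ (by simp)
        (by intro h; have := congrArg List.length h; simp at this; omega)
      rw [val_cons] at this
      simp only [letterVal] at this
      push_cast at this
      linarith
  · rintro ⟨v, hv, rfl⟩
    have key : IsFactorFree m (wrap m v) ∧ val m v = 0 ∧
        ∀ w₁ : List Letter, w₁ <+: v → -2 * (m : ℤ) < val m w₁ := by
      rcases hv with rfl | ⟨h1, h2, _, h4⟩
      · refine ⟨isFactorFree_wrap_nil m, by simp [val], ?_⟩
        intro p hp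
        rw [List.prefix_nil.mp hp]
        simp [val]
        omega
      · exact ⟨h1, h2, h4⟩
    obtain ⟨h1, h2, h3⟩ := key
    refine ⟨h1, ?_, ?_⟩
    · rw [wrap, val_cons, val_append, val_replicate_b, h2]
      simp only [letterVal]
      push_cast
      ring
    · intro p hp hne hnw
      cases p with
      | nil => exact absurd rfl hne
      | cons c p =>
        rw [wrap, List.cons_prefix_cons] at hp
        obtain ⟨rfl, hp⟩ := hp
        rw [val_cons]
        simp only [letterVal]
        rcases List.prefix_or_prefix_of_prefix hp (List.prefix_append v _) with hp | ⟨r, rfl⟩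
        · have := h3 p hp
          push_cast
          linarith
        · obtain ⟨hlen, hr'⟩ :=
            List.prefix_replicate_iff.mp ((List.prefix_append_right_inj v).mp hp)
          rw [hr', val_append, val_replicate_b, h2]
          have : r.length ≠ m := by
            intro h
            apply hnw
            rw [wrap, ← h, ← hr']
          push_cast
          omega

/-- The set of words of length `(2m+3)n` in the auxiliary language. -/
def auxWords (m n : ℕ) : Set (List Letter) :=
  {w | w ∈ auxLang m ∧ w.length = (2 * m + 3) * n}

theorem auxWords_finite (m n : ℕ) : (auxWords m n).Finite :=
  (List.finite_length_eq Letter ((2 * m + 3) * n)).subset fun _ hw => hw.2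

/-- `u_n`, the number of words of length `(2m+3)n` in the auxiliary language. -/
noncomputable def auxCount (m n : ℕ) : ℕ :=
  (auxWords m n).ncard

/-- `μ_j = C(m+j, m-j)`, which is `0` for `j > m` (negative lower index). -/
def mu (m j : ℕ) : ℕ :=
  if j ≤ m then (m + j).choose (m - j) else 0

/-- The partial Bell polynomial
`B_{n,k}(x₁, x₂, …) = ∑ n! / (c₁! c₂! ⋯ (1!)^{c₁} (2!)^{c₂} ⋯) x₁^{c₁} x₂^{c₂} ⋯`,
the sum being over all `c₁, c₂, … ≥ 0` with `∑ cᵢ = k` and `∑ i cᵢ = n`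
(so that `cᵢ = 0` for `i > n`). The variable `x₀` does not occur. -/
noncomputable def partialBell (n k : ℕ) : MvPolynomial ℕ ℚ :=
  ∑ c ∈ ((Finset.Icc 1 n).piAntidiag k).filter
      (fun c : ℕ → ℕ => ∑ i ∈ Finset.Icc 1 n, i * c i = n),
    MvPolynomial.C ((n.factorial : ℚ) /
        ∏ i ∈ Finset.Icc 1 n, ((c i).factorial : ℚ) * (i.factorial : ℚ) ^ c i) *
      ∏ i ∈ Finset.Icc 1 n, MvPolynomial.X i ^ c i

end FactorFree

/-!
Every word of `L_1` is `a v` with `v` a descent to `-2m`: a word without Dyck factors that reaches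
`-2m` for the first time at its end. Cut a descent to `-k` just before it first becomes negative.
The part before the cut is a nonnegative word without Dyck factors that ends at height `0` or `1`,
hence is empty or belongs to `L_1`, and the next letter is `b`. So the descents satisfy
`D_k = b D_{k-2} + L_1 b D_{k-1}`, a recurrence of Fibonacci type whose solution expresses `D_{2m}`
by binomial coefficients. As `a D_{2m} = L_1 = a U b^m`, this is the functional equation
`U = f(t U^2)` with `f = ∑ μ_j t^j`, and Lagrange inversion extracts the coefficients of `U`.
-/

namespace FactorFree

open PowerSeries
open Finset.HasAntidiagonal (antidiagonal)

section LagrangeInversion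

variable {R : Type*} [CommRing R]

theorem eq_of_eq_aeval_X_mul_pow {f : Polynomial R} {d : ℕ} {V W : R⟦X⟧}
    (hV : V = Polynomial.aeval (X * V ^ d) f) (hW : W = Polynomial.aeval (X * W ^ d) f) :
    V = W := by
  have hdvd : X * (V - W) ∣ V - W := by
    calc X * (V - W) ∣ X * (V ^ d - W ^ d) := mul_dvd_mul_left X (sub_dvd_pow_sub_pow V W d)
      _ = X * V ^ d - X * W ^ d := mul_sub _ _ _
      _ ∣ Polynomial.aeval (X * V ^ d) f - Polynomial.aeval (X * W ^ d) f := by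
        simpa only [Polynomial.eval_map_algebraMap] using
          Polynomial.sub_dvd_eval_sub (X * V ^ d) (X * W ^ d) (f.map (algebraMap R R⟦X⟧))
      _ = V - W := by rw [← hV, ← hW]
  obtain ⟨q, hq⟩ := hdvd
  have hunit : IsUnit (1 - X * q) := isUnit_iff_constantCoeff.mpr (by simp)
  have hzero : (1 - X * q) * (V - W) = 0 := by linear_combination hq
  exact sub_eq_zero.mp (hunit.mul_right_eq_zero.mp hzero)

theorem coeff_pow_succ_of_eq_aeval_X_mul_pow {f : Polynomial R} {d : ℕ} {V : R⟦X⟧}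
    (hV : V = Polynomial.aeval (X * V ^ d) f) (n r : ℕ) :
    coeff n (V ^ (r + 1)) =
      ∑ p ∈ antidiagonal n, f.coeff p.1 * coeff p.2 (V ^ (r + d * p.1)) := by
  have hexpand : V ^ (r + 1) = ∑ j ∈ Finset.range (f.natDegree + n + 1),
      C (f.coeff j) * (X ^ j * V ^ (r + d * j)) := by
    rw [pow_succ]
    nth_rewrite 2 [hV]
    rw [Polynomial.aeval_eq_sum_range' (n := f.natDegree + n + 1) (by omega), Finset.mul_sum]
    refine Finset.sum_congr rfl fun j _ => ?_
    rw [smul_eq_C_mul, pow_add, pow_mul]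
    ring
  rw [hexpand, map_sum, Finset.Nat.sum_antidiagonal_eq_sum_range_succ_mk]
  simp only [coeff_C_mul, coeff_X_pow_mul']
  symm
  refine Finset.sum_subset_zero_on_sdiff (Finset.range_subset_range.mpr (by omega)) ?_ ?_
  · intro j hj
    simp only [Finset.mem_sdiff, Finset.mem_range] at hj
    rw [if_neg (by omega), mul_zero]
  · intro j hj
    rw [if_pos (by simpa [Nat.lt_succ_iff] using hj)]

theorem sum_antidiagonal_coeff_mul_coeff_pow (f : Polynomial R) (n N : ℕ) :
    (N + 1 : R) * ∑ p ∈ antidiagonal n, (p.1 * f.coeff p.1) * (f ^ N).coeff p.2 =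
      n * (f ^ (N + 1)).coeff n := by
  have hcoeff (g : Polynomial R) (k : ℕ) :
      (Polynomial.X * Polynomial.derivative g).coeff k = k * g.coeff k := by
    cases k with
    | zero => simp
    | succ k => rw [Polynomial.coeff_X_mul, Polynomial.coeff_derivative]; push_cast; ring
  simp only [← hcoeff]
  rw [← Polynomial.coeff_mul, Polynomial.derivative_pow, Nat.add_sub_cancel,
    ← Polynomial.coeff_C_mul]
  congr 1
  simp only [Nat.cast_add, Nat.cast_one, map_add, map_natCast, map_one]
  ring

theorem lagrange_inversion_pow_succ [IsDomain R] [CharZero R] {f : Polynomial R} {d : ℕ}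
    {V : R⟦X⟧} (hV : V = Polynomial.aeval (X * V ^ d) f) {n r N : ℕ} (hN : N = d * n + r)
    (ih : ∀ p ∈ antidiagonal n, (N : R) * coeff p.2 (V ^ (r + d * p.1)) =
      ((r + d * p.1 : ℕ) : R) * (f ^ N).coeff p.2) :
    ((N + 1 : ℕ) : R) * coeff n (V ^ (r + 1)) =
      ((r + 1 : ℕ) : R) * (f ^ (N + 1)).coeff n := by
  rw [coeff_pow_succ_of_eq_aeval_X_mul_pow hV]
  set S := ∑ p ∈ antidiagonal n, f.coeff p.1 * coeff p.2 (V ^ (r + d * p.1)) with hS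
  rcases Nat.eq_zero_or_pos N with hN0 | hNpos
  · have hS_eq : S = (f ^ (N + 1)).coeff n := by
      rw [hS, pow_succ', Polynomial.coeff_mul]
      refine Finset.sum_congr rfl fun p hp => ?_
      have hle : d * p.1 ≤ d * n :=
        Nat.mul_le_mul_left d (Finset.HasAntidiagonal.antidiagonal.fst_le hp)
      rw [show r + d * p.1 = 0 by omega, hN0, pow_zero, pow_zero, coeff_one, Polynomial.coeff_one]
    rw [hS_eq, hN0, show r = 0 by omega]
  · have hNS : N * S = r * (f ^ (N + 1)).coeff n +
        d * ∑ p ∈ antidiagonal n, (p.1 * f.coeff p.1) * (f ^ N).coeff p.2 := by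
      rw [hS, pow_succ', Polynomial.coeff_mul, Finset.mul_sum, Finset.mul_sum, Finset.mul_sum,
        ← Finset.sum_add_distrib]
      refine Finset.sum_congr rfl fun p hp => ?_
      rw [mul_left_comm, ih p hp]
      push_cast
      ring
    have hderiv := sum_antidiagonal_coeff_mul_coeff_pow f n N
    have hNcast : (N : R) = d * n + r := by rw [hN]; push_cast; ring
    refine mul_left_cancel₀ (Nat.cast_ne_zero.mpr hNpos.ne' : (N : R) ≠ 0) ?_
    push_cast
    linear_combination (N + 1 : R) * hNS + d * hderiv - (f ^ (N + 1)).coeff n * hNcast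

theorem lagrange_inversion_pow [IsDomain R] [CharZero R] {f : Polynomial R} {d : ℕ} {V : R⟦X⟧}
    (hV : V = Polynomial.aeval (X * V ^ d) f) (n r : ℕ) :
    ((d * n + r : ℕ) : R) * coeff n (V ^ r) = r * (f ^ (d * n + r)).coeff n := by
  induction n using Nat.strong_induction_on generalizing r with
  | _ n ihn =>
  induction r with
  | zero =>
    rcases Nat.eq_zero_or_pos n with rfl | hn
    · simp
    · simp [coeff_one, hn.ne']
  | succ r ihr =>
    refine lagrange_inversion_pow_succ hV (N := d * n + r) rfl ?_
    rintro ⟨i, j⟩ hij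
    obtain rfl : i + j = n := Finset.HasAntidiagonal.mem_antidiagonal.mp hij
    obtain rfl | hi := Nat.eq_zero_or_pos i
    · simpa using ihr
    -- The exponent `N = d * n + r` does not depend on the term of the recursion.
    · have hexp : d * j + (r + d * i) = d * (i + j) + r := by ring
      simpa only [hexp] using ihn j (by omega) (r + d * i)

end LagrangeInversion

section BellPolynomial

theorem coeff_pow_eq_sum_piAntidiag {R : Type*} [CommSemiring R] {g : R⟦X⟧}
    (hg : constantCoeff g = 0) (n k : ℕ) :
    coeff n (g ^ k) =
      ∑ c ∈ ((Finset.Icc 1 n).piAntidiag k).filter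
          (fun c : ℕ → ℕ => ∑ i ∈ Finset.Icc 1 n, i * c i = n),
        (Nat.multinomial (Finset.Icc 1 n) c : R) * ∏ i ∈ Finset.Icc 1 n, coeff i g ^ c i := by
  have htrunc : (trunc (n + 1) g : R⟦X⟧) = ∑ i ∈ Finset.Icc 1 n, C (coeff i g) * X ^ i := by
    ext j
    simp only [coeff_trunc, Polynomial.coeff_coe, map_sum, coeff_C_mul, coeff_X_pow, mul_ite,
      mul_one, mul_zero, Finset.sum_ite_eq, Finset.mem_Icc]
    rcases Nat.eq_zero_or_pos j with rfl | hj
    · simpa using hg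
    · exact if_congr (by omega) rfl rfl
  have hmonomial (c : ℕ → ℕ) :
      (Nat.multinomial (Finset.Icc 1 n) c : R⟦X⟧) *
          ∏ i ∈ Finset.Icc 1 n, (C (coeff i g) * X ^ i) ^ c i =
        C ((Nat.multinomial (Finset.Icc 1 n) c : R) * ∏ i ∈ Finset.Icc 1 n, coeff i g ^ c i) *
          X ^ (∑ i ∈ Finset.Icc 1 n, i * c i) := by
    simp only [mul_pow, ← pow_mul, Finset.prod_mul_distrib, Finset.prod_pow_eq_pow_sum, map_mul,
      map_natCast, map_prod, map_pow, mul_assoc]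
  calc coeff n (g ^ k) = coeff n ((trunc (n + 1) g : R⟦X⟧) ^ k) := by
        rw [← coeff_coe_trunc_of_lt n.lt_succ_self, ← trunc_trunc_pow,
          coeff_coe_trunc_of_lt n.lt_succ_self]
    _ = _ := by
        rw [htrunc, Finset.sum_pow_eq_sum_piAntidiag, map_sum, Finset.sum_filter]
        simp only [hmonomial, coeff_C_mul, coeff_X_pow, mul_ite, mul_one, mul_zero, eq_comm]

theorem eval_partialBell (f : ℚ⟦X⟧) (n k : ℕ) :
    MvPolynomial.eval (fun j => (j.factorial : ℚ) * coeff j f) (partialBell n k) =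
      n.factorial / k.factorial * coeff n ((f - C (constantCoeff f)) ^ k) := by
  rw [coeff_pow_eq_sum_piAntidiag (by simp), partialBell, map_sum, Finset.mul_sum]
  refine Finset.sum_congr rfl fun c hc => ?_
  have hcoeff : ∏ i ∈ Finset.Icc 1 n, coeff i (f - C (constantCoeff f)) ^ c i =
      ∏ i ∈ Finset.Icc 1 n, coeff i f ^ c i := by
    refine Finset.prod_congr rfl fun i hi => ?_
    have hi0 : i ≠ 0 := Nat.one_le_iff_ne_zero.mp (Finset.mem_Icc.mp hi).1
    rw [map_sub, coeff_C, if_neg hi0, sub_zero]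
  have hk : ∑ i ∈ Finset.Icc 1 n, c i = k :=
    (Finset.mem_piAntidiag.mp (Finset.mem_filter.mp hc).1).1
  have hmultinomial : (∏ i ∈ Finset.Icc 1 n, ((c i).factorial : ℚ)) *
      Nat.multinomial (Finset.Icc 1 n) c = k.factorial := by
    exact_mod_cast hk ▸ Nat.multinomial_spec (Finset.Icc 1 n) c
  have hfact : ∏ i ∈ Finset.Icc 1 n, ((c i).factorial : ℚ) ≠ 0 :=
    Finset.prod_ne_zero_iff.mpr fun i _ => Nat.cast_ne_zero.mpr (c i).factorial_ne_zero
  have hfactpow : ∏ i ∈ Finset.Icc 1 n, (i.factorial : ℚ) ^ c i ≠ 0 :=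
    Finset.prod_ne_zero_iff.mpr fun i _ =>
      pow_ne_zero _ (Nat.cast_ne_zero.mpr i.factorial_ne_zero)
  have hkfact : (k.factorial : ℚ) ≠ 0 := Nat.cast_ne_zero.mpr k.factorial_ne_zero
  simp only [map_mul, MvPolynomial.eval_C, map_prod, map_pow, MvPolynomial.eval_X, mul_pow,
    Finset.prod_mul_distrib]
  rw [hcoeff]
  field_simp
  linear_combination -(∏ i ∈ Finset.Icc 1 n, coeff i f ^ c i) * hmultinomial

theorem coeff_one_add_pow {R : Type*} [CommSemiring R] {g : R⟦X⟧} (hg : constantCoeff g = 0)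
    {n : ℕ} (hn : n ≠ 0) (N : ℕ) :
    coeff n ((1 + g) ^ N) = ∑ k ∈ Finset.Icc 1 n, (N.choose k : R) * coeff n (g ^ k) := by
  have hvanish (k : ℕ) (hk : n < k) : coeff n (g ^ k) = 0 :=
    X_pow_dvd_iff.mp (pow_dvd_pow_of_dvd (X_dvd_iff.mpr hg) k) n hk
  simp only [add_comm (1 : R⟦X⟧), add_pow, one_pow, mul_one, map_sum, ← map_natCast (C (R := R)),
    coeff_mul_C, mul_comm (coeff n _)]
  refine Finset.sum_congr_of_eq_on_inter (fun k _ hk => ?_) (fun k _ hk => ?_) fun _ _ _ => rfl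
  · rw [Finset.mem_Icc, not_and_or, not_le, not_le, Nat.lt_one_iff] at hk
    rcases hk with rfl | hk
    · rw [pow_zero, coeff_one, if_neg hn, mul_zero]
    · rw [hvanish k hk, mul_zero]
  · rw [Finset.mem_range, not_lt] at hk
    rw [Nat.choose_eq_zero_of_lt hk, Nat.cast_zero, zero_mul]

theorem coeff_eq_sum_partialBell {f : Polynomial ℚ} (hf : f.coeff 0 = 1) {d : ℕ} {V : ℚ⟦X⟧}
    (hV : V = Polynomial.aeval (X * V ^ d) f) {n : ℕ} (hn : n ≠ 0) :
    coeff n V = ∑ k ∈ Finset.Icc 1 n,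
      ((d * n).choose (k - 1) : ℚ) * ((k - 1).factorial / n.factorial) *
        MvPolynomial.eval (fun j => (j.factorial : ℚ) * f.coeff j) (partialBell n k) := by
  have hf0 : constantCoeff (f : ℚ⟦X⟧) = 1 := by simpa using hf
  have hlagrange : ((d * n + 1 : ℕ) : ℚ) * coeff n V =
      ∑ k ∈ Finset.Icc 1 n, ((d * n + 1).choose k : ℚ) * coeff n ((f - 1 : ℚ⟦X⟧) ^ k) := by
    rw [← coeff_one_add_pow (by simp [hf0]) hn, add_sub_cancel, ← Polynomial.coe_pow,
      Polynomial.coeff_coe]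
    simpa using lagrange_inversion_pow hV n 1
  refine mul_left_cancel₀ (Nat.cast_ne_zero.mpr (d * n).succ_ne_zero : ((d * n + 1 : ℕ) : ℚ) ≠ 0) ?_
  rw [hlagrange, Finset.mul_sum]
  refine Finset.sum_congr rfl fun k hk => ?_
  obtain ⟨k, rfl⟩ := Nat.exists_eq_add_of_le' (Finset.mem_Icc.mp hk).1
  have hbell := eval_partialBell (f : ℚ⟦X⟧) n (k + 1)
  rw [hf0, map_one] at hbell
  simp only [Polynomial.coeff_coe] at hbell
  have hchoose : ((d * n + 1 : ℕ) : ℚ) * (d * n).choose k =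
      (d * n + 1).choose (k + 1) * ((k + 1 : ℕ) : ℚ) := by
    exact_mod_cast Nat.add_one_mul_choose_eq (d * n) k
  rw [hbell, Nat.add_sub_cancel, Nat.factorial_succ]
  have hnfact : (n.factorial : ℚ) ≠ 0 := Nat.cast_ne_zero.mpr n.factorial_ne_zero
  have hkfact : (k.factorial : ℚ) ≠ 0 := Nat.cast_ne_zero.mpr k.factorial_ne_zero
  push_cast at hchoose ⊢
  field_simp
  linear_combination -coeff n ((f - 1 : ℚ⟦X⟧) ^ (k + 1)) * hchoose

end BellPolynomial

theorem eq_sum_choose_of_fib_recurrence {R : Type*} [CommSemiring R] {T E : R} {s : ℕ → R}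
    (h0 : s 0 = 1) (h1 : s 1 = E) (hs : ∀ k, s (k + 2) = T * s k + E * s (k + 1)) (k : ℕ) :
    s k = ∑ p ∈ antidiagonal k, (p.1.choose p.2 : R) * T ^ p.2 * E ^ (p.1 - p.2) := by
  induction k using Nat.twoStepInduction with
  | zero => simp [h0]
  | one => simp [h1, Finset.Nat.antidiagonal_succ]
  | more k ih0 ih1 =>
    have hpascal (i j : ℕ) :
        ((i + 1).choose (j + 1) : R) * T ^ (j + 1) * E ^ (i + 1 - (j + 1)) =
          T * ((i.choose j : R) * T ^ j * E ^ (i - j)) +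
            E * ((i.choose (j + 1) : R) * T ^ (j + 1) * E ^ (i - (j + 1))) := by
      rw [Nat.choose_succ_succ, Nat.add_sub_add_right]
      rcases lt_or_ge j i with h | h
      · rw [show i - j = i - (j + 1) + 1 by omega]
        push_cast
        ring
      · rw [Nat.choose_eq_zero_of_lt (by omega : i < j + 1)]
        push_cast
        ring
    rw [hs, ih0, ih1, Finset.Nat.antidiagonal_succ_succ', Finset.Nat.antidiagonal_succ']
    simp only [Finset.sum_cons, Finset.sum_map, Function.Embedding.coe_prodMap, Prod.map,
      Function.Embedding.coeFn_mk, Function.Embedding.refl_apply, Nat.succ_eq_add_one, hpascal,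
      Finset.sum_add_distrib, Finset.mul_sum, mul_add]
    simp only [Nat.choose_zero_right, Nat.cast_one, pow_zero, mul_one, tsub_zero, pow_succ',
      one_mul, Nat.choose_zero_succ, Nat.cast_zero, zero_mul, zero_tsub, zero_add]
    ring

theorem expand_injective {R : Type*} [CommRing R] {d : ℕ} (hd : d ≠ 0) :
    Function.Injective (expand (R := R) d hd) := by
  intro F G h
  ext n
  simpa only [coeff_expand_mul] using congrArg (coeff (d * n)) h

section LengthGF

variable {α : Type*}

/-- The words of length `n` of a language. -/
def wordsOfLength (L : Language α) (n : ℕ) : Set (List α) :=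
  {w | w ∈ L ∧ w.length = n}

/-- The generating function of a language by length: the coefficient of `X ^ n` is the number of
words of length `n`. Since `Set.ncard` of an infinite set is `0`, it is meaningful only over a
finite alphabet. -/
noncomputable def lengthGF (L : Language α) : ℕ⟦X⟧ :=
  mk fun n => (wordsOfLength L n).ncard

theorem coeff_lengthGF (L : Language α) (n : ℕ) :
    coeff n (lengthGF L) = (wordsOfLength L n).ncard :=
  coeff_mk n _

theorem finite_wordsOfLength [Finite α] (L : Language α) (n : ℕ) : (wordsOfLength L n).Finite :=
  (List.finite_length_eq α n).subset fun _ hw => hw.2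

theorem lengthGF_zero : lengthGF (0 : Language α) = 0 := by
  ext n
  simp [coeff_lengthGF, wordsOfLength]

theorem lengthGF_singleton (v : List α) : lengthGF ({v} : Language α) = X ^ v.length := by
  ext n
  rw [coeff_lengthGF, coeff_X_pow]
  split_ifs with h
  · refine Set.ncard_eq_one.mpr ⟨v, Set.ext fun w => ⟨fun hw => hw.1, ?_⟩⟩
    rintro rfl
    exact ⟨rfl, h.symm⟩
  · rw [show wordsOfLength ({v} : Language α) n = ∅ from
      Set.eq_empty_of_forall_notMem (by rintro _ ⟨rfl, hw⟩; exact h hw.symm), Set.ncard_empty]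

theorem lengthGF_add [Finite α] {L M : Language α} (h : ∀ w ∈ L, w ∉ M) :
    lengthGF (L + M) = lengthGF L + lengthGF M := by
  ext n
  have hunion : wordsOfLength (L + M) n = wordsOfLength L n ∪ wordsOfLength M n := by
    ext w
    simp only [wordsOfLength, Language.mem_add, Set.mem_union, Set.mem_ofPred_eq, or_and_right]
  have hdisj : Disjoint (wordsOfLength L n) (wordsOfLength M n) :=
    Set.disjoint_left.mpr fun w hL hM => h w hL.1 hM.1
  simp only [map_add, coeff_lengthGF]
  rw [hunion, Set.ncard_union_eq hdisj (finite_wordsOfLength L n) (finite_wordsOfLength M n)]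

theorem wordsOfLength_mul (L M : Language α) (n : ℕ) :
    wordsOfLength (L * M) n = ⋃ p : (antidiagonal n : Finset (ℕ × ℕ)),
      Set.image2 (· ++ ·) (wordsOfLength L p.1.1) (wordsOfLength M p.1.2) := by
  ext w
  simp only [Set.mem_iUnion]
  constructor
  · rintro ⟨hw, hn⟩
    obtain ⟨u, hu, v, hv, rfl⟩ := Language.mem_mul.mp hw
    exact ⟨⟨(u.length, v.length), by simpa using hn⟩, u, ⟨hu, rfl⟩, v, ⟨hv, rfl⟩, rfl⟩
  · rintro ⟨⟨⟨i, j⟩, hij⟩, u, ⟨hu, rfl⟩, v, ⟨hv, rfl⟩, rfl⟩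
    exact ⟨Language.mem_mul.mpr ⟨u, hu, v, hv, rfl⟩, by simpa using hij⟩

theorem lengthGF_mul [Finite α] {L M : Language α}
    (h : Set.InjOn (fun p : List α × List α => p.1 ++ p.2) {p | p.1 ∈ L ∧ p.2 ∈ M}) :
    lengthGF (L * M) = lengthGF L * lengthGF M := by
  ext n
  have hinj (p : ℕ × ℕ) : Set.InjOn (fun q : List α × List α => q.1 ++ q.2)
      (wordsOfLength L p.1 ×ˢ wordsOfLength M p.2) :=
    h.mono fun q hq => And.intro hq.1.1 hq.2.1
  have hdisj : Pairwise (Function.onFun Disjoint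
      fun p : (antidiagonal n : Finset (ℕ × ℕ)) =>
        Set.image2 (· ++ ·) (wordsOfLength L p.1.1) (wordsOfLength M p.1.2)) := by
    rintro ⟨⟨i, j⟩, _⟩ ⟨⟨i', j'⟩, _⟩ hne
    refine Set.disjoint_left.mpr ?_
    rintro _ ⟨u, ⟨hu, rfl⟩, v, ⟨hv, rfl⟩, rfl⟩ ⟨u', ⟨hu', rfl⟩, v', ⟨hv', rfl⟩, e⟩
    obtain ⟨rfl, rfl⟩ := Prod.mk.inj (@h (u', v') ⟨hu', hv'⟩ (u, v) ⟨hu, hv⟩ e)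
    exact hne rfl
  rw [coeff_lengthGF, coeff_mul, wordsOfLength_mul,
    Set.ncard_iUnion_of_finite
      (fun p => (finite_wordsOfLength L _).image2 _ (finite_wordsOfLength M _)) hdisj,
    finsum_eq_sum_of_fintype, ← Finset.sum_coe_sort (antidiagonal n)]
  refine Finset.sum_congr rfl fun p _ => ?_
  rw [← Set.image_prod, (hinj p).ncard_image, Set.ncard_prod, coeff_lengthGF, coeff_lengthGF]

theorem injOn_append_of_isAntichain {L M : Language α} (hL : IsAntichain (· <+: ·) {w | w ∈ L}) :
    Set.InjOn (fun p : List α × List α => p.1 ++ p.2) {p | p.1 ∈ L ∧ p.2 ∈ M} := by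
  rintro ⟨u, v⟩ ⟨hu, -⟩ ⟨u', v'⟩ ⟨hu', -⟩ (e : u ++ v = u' ++ v')
  have hprefix : u <+: u' ∨ u' <+: u :=
    List.prefix_or_prefix_of_prefix (e ▸ List.prefix_append u v) (List.prefix_append u' v')
  have huu' : u = u' := hprefix.elim (hL.eq hu hu') (hL.eq' hu hu')
  subst huu'
  simpa using e

theorem lengthGF_singleton_mul [Finite α] (v : List α) (L : Language α) :
    lengthGF ({v} * L) = X ^ v.length * lengthGF L := by
  rw [lengthGF_mul, lengthGF_singleton]
  rintro ⟨_, w⟩ ⟨rfl, -⟩ ⟨_, w'⟩ ⟨rfl, -⟩ e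
  simpa using e

theorem lengthGF_mul_singleton [Finite α] (L : Language α) (v : List α) :
    lengthGF (L * {v}) = lengthGF L * X ^ v.length := by
  rw [lengthGF_mul, lengthGF_singleton]
  rintro ⟨w, _⟩ ⟨-, rfl⟩ ⟨w', _⟩ ⟨-, rfl⟩ e
  simpa using e

theorem mem_singleton_mul {v w : List α} {L : Language α} :
    w ∈ ({v} : Language α) * L ↔ ∃ u ∈ L, w = v ++ u := by
  rw [Language.mem_mul]
  exact ⟨by rintro ⟨_, rfl, u, hu, rfl⟩; exact ⟨u, hu, rfl⟩,
    by rintro ⟨u, hu, rfl⟩; exact ⟨v, rfl, u, hu, rfl⟩⟩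

end LengthGF

section Words

variable {m : ℕ} {k : ℤ} {u v w : List Letter}

/-- Every left factor of `w` has nonnegative valuation. -/
def StaysNonneg (m : ℕ) (w : List Letter) : Prop :=
  ∀ p, p <+: w → 0 ≤ val m p

/-- No factor of `w` is a nonempty generalized Dyck word. In contrast to `IsFactorFree`, the word
`w` counts as a factor of itself, so that the property passes to factors. -/
def DyckFree (m : ℕ) (w : List Letter) : Prop :=
  ∀ y, y <:+: w → y ≠ [] → y ∉ dyckWords m

/-- The words without nonempty Dyck factors that reach the valuation `-k` for the first time at
their end. -/
def descents (m : ℕ) (k : ℤ) : Language Letter :=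
  {v | DyckFree m v ∧ val m v = -k ∧ ∀ p, p <+: v → p ≠ v → -k < val m p}

theorem val_nil (m : ℕ) : val m [] = 0 := rfl

theorem val_cons_a (m : ℕ) (w : List Letter) :
    val m (Letter.a :: w) = 2 * (m : ℤ) + 1 + val m w :=
  val_cons m _ w

theorem val_cons_b (m : ℕ) (w : List Letter) : val m (Letter.b :: w) = -2 + val m w :=
  val_cons m _ w

theorem staysNonneg_nil (m : ℕ) : StaysNonneg m [] := by
  intro p hp
  rw [List.prefix_nil.mp hp, val_nil]

theorem StaysNonneg.of_prefix (hw : StaysNonneg m w) (hv : v <+: w) : StaysNonneg m v :=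
  fun p hp => hw p (hp.trans hv)

theorem dyckFree_nil (m : ℕ) : DyckFree m [] :=
  fun _ hy hne => absurd (List.infix_nil.mp hy) hne

theorem DyckFree.of_infix (hw : DyckFree m w) (hv : v <:+: w) : DyckFree m v :=
  fun y hy => hw y (hy.trans hv)

theorem DyckFree.isFactorFree (hw : DyckFree m w) : IsFactorFree m w :=
  fun w₁ w' w₂ e _ => hw w' ⟨w₁, w₂, e.symm⟩

theorem IsFactorFree.dyckFree (hw : IsFactorFree m w) (hval : val m w ≠ 0) : DyckFree m w := by
  rintro y ⟨w₁, w₂, rfl⟩ hne hy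
  refine hw w₁ y w₂ rfl ?_ hne hy
  rintro ⟨rfl, rfl⟩
  simp only [List.nil_append, List.append_nil] at hval
  exact hval hy.1

theorem DyckFree.val_pos_of_prefix (hw : DyckFree m w) (hnonneg : StaysNonneg m w) {p : List Letter}
    (hp : p <+: w) (hne : p ≠ []) : 0 < val m p :=
  (hnonneg p hp).lt_of_ne' fun h0 => hw p hp.isInfix hne ⟨h0, hnonneg.of_prefix hp⟩

theorem mem_langL_one_iff_staysNonneg :
    u ∈ langL m 1 ↔ DyckFree m u ∧ StaysNonneg m u ∧ val m u = 1 := by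
  constructor
  · rintro ⟨hfree, hval, hprefix⟩
    rw [Nat.cast_one] at hval hprefix
    refine ⟨hfree.dyckFree (by omega), fun p hp => ?_, hval⟩
    rcases eq_or_ne p [] with rfl | hnil
    · rw [val_nil]
    rcases eq_or_ne p u with rfl | hpu
    · omega
    · linarith [hprefix p hp hnil hpu]
  · rintro ⟨hfree, hnonneg, hval⟩
    refine ⟨hfree.isFactorFree, by exact_mod_cast hval, ?_⟩
    rintro p ⟨r, rfl⟩ hp hne
    rw [Nat.cast_one]
    refine lt_of_le_of_ne (hfree.val_pos_of_prefix hnonneg (List.prefix_append p r) hp) fun h1 => ?_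
    -- If `p` already has valuation `1`, the rest `r` of the word is a Dyck word.
    refine hfree r (List.suffix_append p r).isInfix (by rintro rfl; simp at hne)
      ⟨?_, fun q hq => ?_⟩
    · rw [val_append] at hval
      omega
    · have hpq := hfree.val_pos_of_prefix hnonneg
        ((List.prefix_append_right_inj p).mpr hq) (by simp [hp])
      rw [val_append] at hpq
      omega

theorem isAntichain_langL_one (m : ℕ) : IsAntichain (· <+: ·) {u | u ∈ langL m 1} := by
  rintro u ⟨-, hu, -⟩ v ⟨-, -, hv⟩ hne hprefix
  have hnil : u ≠ [] := by
    rintro rfl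
    simp [val_nil] at hu
  exact (hv u hprefix hnil hne).ne' hu

theorem cons_a_mem_langL_one_iff : Letter.a :: v ∈ langL m 1 ↔ v ∈ descents m (2 * m) := by
  constructor
  · intro hv
    obtain ⟨hfree, -, hval⟩ := mem_langL_one_iff_staysNonneg.mp hv
    rw [val_cons_a] at hval
    refine ⟨hfree.of_infix (List.suffix_cons _ _).isInfix, by omega, fun p hp hne => ?_⟩
    have hlt := hv.2.2 (Letter.a :: p) (List.cons_prefix_cons.mpr ⟨rfl, hp⟩) (by simp)
      (by simpa using hne)
    rw [val_cons_a] at hlt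
    omega
  · rintro ⟨hfree, hval, hprefix⟩
    have hpos (p : List Letter) (hp : p <+: v) : 0 < val m (Letter.a :: p) := by
      rw [val_cons_a]
      rcases eq_or_ne p v with rfl | hne
      · omega
      · linarith [hprefix p hp hne]
    refine mem_langL_one_iff_staysNonneg.mpr ⟨fun y hy hne hdyck => ?_, fun p hp => ?_, ?_⟩
    · rcases List.infix_cons_iff.mp hy with hy | hy
      · obtain rfl | ⟨p, rfl, hp⟩ := List.prefix_cons_iff.mp hy
        · exact hne rfl
        · exact (hpos p hp).ne' hdyck.1
      · exact hfree y hy hne hdyck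
    · obtain rfl | ⟨q, rfl, hq⟩ := List.prefix_cons_iff.mp hp
      · rw [val_nil]
      · exact (hpos q hq).le
    · rw [val_cons_a, hval]
      ring

theorem langL_one_eq_a_mul_descents (m : ℕ) :
    langL m 1 = {[Letter.a]} * descents m (2 * m) := by
  ext w
  rw [mem_singleton_mul]
  constructor
  · intro hw
    obtain ⟨v, rfl⟩ := exists_wrap_of_mem m w hw 0 m.zero_le
    rw [List.replicate_zero, List.append_nil] at hw ⊢
    exact ⟨v, cons_a_mem_langL_one_iff.mp hw, rfl⟩
  · rintro ⟨v, hv, rfl⟩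
    exact cons_a_mem_langL_one_iff.mpr hv

theorem langL_one_eq_a_mul_auxLang_mul_b (hm : 1 ≤ m) :
    langL m 1 = {[Letter.a]} * (auxLang m * {List.replicate m Letter.b}) := by
  ext w
  rw [mem_langL_one_iff m hm, mem_singleton_mul]
  constructor
  · rintro ⟨v, hv, rfl⟩
    exact ⟨_, Language.mem_mul.mpr ⟨v, hv, _, rfl, rfl⟩, rfl⟩
  · rintro ⟨_, hu, rfl⟩
    obtain ⟨v, hv, _, rfl, rfl⟩ := Language.mem_mul.mp hu
    exact ⟨v, hv, rfl⟩

theorem StaysNonneg.val_neg_of_suffix_concat_b (hu : StaysNonneg m u) (hu2 : val m u < 2)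
    {s : List Letter} (hs : s <:+ u ++ [Letter.b]) (hne : s ≠ []) : val m s < 0 := by
  obtain ⟨x, hx⟩ := hs
  have hxu : x <+: u := by
    refine (List.prefix_concat_iff.mp ⟨s, hx⟩).resolve_left ?_
    rintro rfl
    simp [hne] at hx
  have hval := congrArg (val m) hx
  rw [val_append, val_append, val_cons_b, val_nil] at hval
  linarith [hu x hxu]

theorem DyckFree.append_cons_b (hu : DyckFree m u) (hnonneg : StaysNonneg m u) (hu2 : val m u < 2)
    (hv : DyckFree m v) : DyckFree m (u ++ Letter.b :: v) := by
  intro y hy hne hdyck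
  rw [List.append_cons, List.infix_append_iff, List.infix_concat_iff] at hy
  obtain (hy | hy) | hy | ⟨s, t, rfl, hs, ht⟩ := hy
  · exact (hnonneg.val_neg_of_suffix_concat_b hu2 hy hne).ne hdyck.1
  · exact hu y hy hne hdyck
  · exact hv y hy hne hdyck
  · rcases eq_or_ne s [] with rfl | hs0
    · exact hv t ht.isInfix hne hdyck
    · exact (hnonneg.val_neg_of_suffix_concat_b hu2 hs hs0).not_ge
        (hdyck.2 s (List.prefix_append s t))

theorem descents_zero (m : ℕ) : descents m 0 = 1 := by
  ext v
  rw [Language.mem_one]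
  constructor
  · rintro ⟨-, -, hprefix⟩
    by_contra hne
    simpa [val_nil] using hprefix [] List.nil_prefix (Ne.symm hne)
  · rintro rfl
    exact ⟨dyckFree_nil m, by rw [val_nil, neg_zero],
      fun p hp hne => absurd (List.prefix_nil.mp hp) hne⟩

theorem descents_of_neg (m : ℕ) (hk : k < 0) : descents m k = 0 := by
  ext v
  refine iff_of_false ?_ (Language.notMem_zero v)
  rintro ⟨-, hval, hprefix⟩
  rcases eq_or_ne [] v with rfl | hne
  · rw [val_nil] at hval
    omega
  · have hlt := hprefix [] List.nil_prefix hne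
    rw [val_nil] at hlt
    omega

theorem exists_first_passage (hw : ¬StaysNonneg m w) :
    ∃ u v, w = u ++ Letter.b :: v ∧ StaysNonneg m u ∧ val m u < 2 := by
  induction w using List.reverseRecOn with
  | nil => exact absurd (staysNonneg_nil m) hw
  | append_singleton w c ih =>
    by_cases hnonneg : StaysNonneg m w
    · have hneg : val m w + val m [c] < 0 := by
        rw [← val_append]
        by_contra! hlast
        refine hw fun p hp => ?_
        rcases List.prefix_concat_iff.mp hp with rfl | hp
        · exact hlast
        · exact hnonneg p hp
      have hw0 := hnonneg w List.prefix_rfl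
      cases c with
      | a =>
        rw [val_cons_a, val_nil] at hneg
        omega
      | b =>
        rw [val_cons_b, val_nil] at hneg
        exact ⟨w, [], rfl, hnonneg, by omega⟩
    · obtain ⟨u, v, rfl, hu, hu2⟩ := ih hnonneg
      exact ⟨u, v ++ [c], by simp, hu, hu2⟩

theorem append_cons_b_mem_descents_iff (hk : 1 ≤ k) (hfree : DyckFree m u)
    (hnonneg : StaysNonneg m u) (hu2 : val m u < 2) :
    u ++ Letter.b :: v ∈ descents m k ↔ v ∈ descents m (k - 2 + val m u) := by
  have hval (p : List Letter) : val m (u ++ Letter.b :: p) = val m u - 2 + val m p := by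
    rw [val_append, val_cons_b]
    ring
  constructor
  · rintro ⟨hw, hvalw, hprefix⟩
    rw [hval] at hvalw
    refine ⟨hw.of_infix ⟨u ++ [Letter.b], [], by simp⟩, by omega, fun p hp hne => ?_⟩
    have hlt := hprefix (u ++ Letter.b :: p) (by simpa using hp) (by simpa using hne)
    rw [hval] at hlt
    omega
  · rintro ⟨hv, hvalv, hprefix⟩
    refine ⟨hfree.append_cons_b hnonneg hu2 hv, by rw [hval, hvalv]; ring, fun p hp hne => ?_⟩
    rw [List.append_cons] at hp
    rcases List.prefix_or_prefix_of_prefix hp (List.prefix_append _ v) with hpu | ⟨q, rfl⟩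
    · rcases List.prefix_concat_iff.mp hpu with rfl | hpu
      · have hlt := hprefix [] List.nil_prefix (by rintro rfl; exact hne rfl)
        rw [val_nil] at hlt
        rw [hval, val_nil]
        omega
      · linarith [hnonneg p hpu]
    · have hlt := hprefix q ((List.prefix_append_right_inj _).mp hp)
        (by rintro rfl; simp at hne)
      rw [List.append_assoc, List.singleton_append, hval]
      omega

theorem descents_eq_add (m : ℕ) (hk : 1 ≤ k) :
    descents m k = {[Letter.b]} * descents m (k - 2) +
      langL m 1 * ({[Letter.b]} * descents m (k - 1)) := by
  have hempty (v : List Letter) : Letter.b :: v ∈ descents m k ↔ v ∈ descents m (k - 2) := by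
    simpa [val_nil] using append_cons_b_mem_descents_iff (v := v) hk (dyckFree_nil m)
      (staysNonneg_nil m) (by simp [val_nil])
  have hlangL (u v : List Letter) (hu : u ∈ langL m 1) :
      u ++ Letter.b :: v ∈ descents m k ↔ v ∈ descents m (k - 1) := by
    obtain ⟨hfree, hnonneg, hval⟩ := mem_langL_one_iff_staysNonneg.mp hu
    rw [append_cons_b_mem_descents_iff hk hfree hnonneg (by omega), hval,
      show k - 2 + 1 = k - 1 by ring]
  ext w
  rw [Language.mem_add, mem_singleton_mul, Language.mem_mul]
  constructor
  · intro hw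
    have hneg : ¬StaysNonneg m w := fun h => by
      linarith [h w List.prefix_rfl, hw.2.1]
    obtain ⟨u, v, rfl, hnonneg, hu2⟩ := exists_first_passage hneg
    have hfree : DyckFree m u := hw.1.of_infix (List.prefix_append u _).isInfix
    rcases eq_or_ne u [] with rfl | hne
    · exact Or.inl ⟨v, (hempty v).mp hw, rfl⟩
    · have hpos := hfree.val_pos_of_prefix hnonneg List.prefix_rfl hne
      have hu : u ∈ langL m 1 := mem_langL_one_iff_staysNonneg.mpr ⟨hfree, hnonneg, by omega⟩
      exact Or.inr ⟨u, hu, _, mem_singleton_mul.mpr ⟨v, (hlangL u v hu).mp hw, rfl⟩, rfl⟩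
  · rintro (⟨v, hv, rfl⟩ | ⟨u, hu, _, hbv, rfl⟩)
    · exact (hempty v).mpr hv
    · obtain ⟨v, hv, rfl⟩ := mem_singleton_mul.mp hbv
      exact (hlangL u v hu).mpr hv

theorem cons_b_notMem_langL_one_mul (M : Language Letter) :
    Letter.b :: v ∉ langL m 1 * M := by
  intro h
  obtain ⟨u, hu, w, -, e⟩ := Language.mem_mul.mp h
  obtain ⟨-, hnonneg, hval⟩ := mem_langL_one_iff_staysNonneg.mp hu
  cases u with
  | nil => simp [val_nil] at hval
  | cons c u =>
    obtain ⟨rfl, -⟩ := List.cons.inj e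
    have hb := hnonneg [Letter.b] (List.cons_prefix_cons.mpr ⟨rfl, List.nil_prefix⟩)
    simp [val_cons_b, val_nil] at hb

theorem val_eq_zero_of_mem_auxLang (hw : w ∈ auxLang m) : val m w = 0 := by
  rcases hw with rfl | ⟨-, hval, -⟩
  · exact val_nil m
  · exact hval

theorem dvd_length_of_val_eq_zero (hw : val m w = 0) : 2 * m + 3 ∣ w.length := by
  have hcount : (2 * m + 1) * w.count Letter.a = 2 * w.count Letter.b := by
    rw [val_eq_count] at hw
    zify
    linarith
  obtain ⟨c, hc⟩ : 2 ∣ w.count Letter.a :=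
    Nat.Coprime.dvd_of_dvd_mul_left (k := 2) (by simp) ⟨_, hcount⟩
  refine ⟨c, ?_⟩
  rw [length_eq_count]
  rw [hc] at hcount ⊢
  linarith

end Words

section GeneratingFunctions

variable {m : ℕ}

theorem sum_antidiagonal_choose_eq_sum_mu {R : Type*} [CommSemiring R] (m : ℕ) (T E : R) :
    ∑ p ∈ antidiagonal (2 * m), (p.1.choose p.2 : R) * T ^ p.2 * E ^ (p.1 - p.2) =
      ∑ j ∈ Finset.range (m + 1), (mu m j : R) * T ^ (m - j) * E ^ (2 * j) := by
  rw [Finset.Nat.sum_antidiagonal_eq_sum_range_succ_mk, show (2 * m).succ = m + (m + 1) by omega,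
    Finset.sum_range_add, Finset.sum_eq_zero, zero_add]
  · refine Finset.sum_congr rfl fun j hj => ?_
    have hj' : j ≤ m := Nat.lt_succ_iff.mp (Finset.mem_range.mp hj)
    rw [mu, if_pos hj', show 2 * m - (m + j) = m - j by omega,
      show m + j - (m - j) = 2 * j by omega]
  · intro i hi
    rw [Finset.mem_range] at hi
    rw [Nat.choose_eq_zero_of_lt (by omega), Nat.cast_zero, zero_mul, zero_mul]

theorem lengthGF_langL_one_eq_descents (m : ℕ) :
    lengthGF (langL m 1) = X * lengthGF (descents m (2 * m)) := by
  rw [langL_one_eq_a_mul_descents, lengthGF_singleton_mul, List.length_singleton, pow_one]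

theorem lengthGF_langL_one_eq_auxLang (hm : 1 ≤ m) :
    lengthGF (langL m 1) = X ^ (m + 1) * lengthGF (auxLang m) := by
  rw [langL_one_eq_a_mul_auxLang_mul_b hm, lengthGF_singleton_mul, lengthGF_mul_singleton,
    List.length_singleton, List.length_replicate]
  ring

theorem lengthGF_descents (m : ℕ) {k : ℤ} (hk : 1 ≤ k) :
    lengthGF (descents m k) = X * lengthGF (descents m (k - 2)) +
      X * lengthGF (langL m 1) * lengthGF (descents m (k - 1)) := by
  have hdisj : ∀ w ∈ ({[Letter.b]} : Language Letter) * descents m (k - 2),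
      w ∉ langL m 1 * ({[Letter.b]} * descents m (k - 1)) := by
    intro w hw
    obtain ⟨v, -, rfl⟩ := mem_singleton_mul.mp hw
    exact cons_b_notMem_langL_one_mul _
  rw [descents_eq_add m hk, lengthGF_add hdisj,
    lengthGF_mul (injOn_append_of_isAntichain (isAntichain_langL_one m)),
    lengthGF_singleton_mul, lengthGF_singleton_mul, List.length_singleton]
  ring

theorem lengthGF_descents_natCast (m k : ℕ) :
    lengthGF (descents m k) = ∑ p ∈ antidiagonal k,
      (p.1.choose p.2 : ℕ⟦X⟧) * X ^ p.2 * (X * lengthGF (langL m 1)) ^ (p.1 - p.2) := by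
  have h0 : lengthGF (descents m 0) = 1 := by
    rw [descents_zero]
    exact lengthGF_singleton []
  refine eq_sum_choose_of_fib_recurrence (s := fun k : ℕ => lengthGF (descents m k)) h0 ?_ ?_ k
  · change lengthGF (descents m 1) = _
    rw [lengthGF_descents m le_rfl, descents_of_neg m (by norm_num), lengthGF_zero, sub_self, h0]
    ring
  · intro k
    have h := lengthGF_descents m (k := (k + 2 : ℕ)) (by omega)
    rwa [show ((k + 2 : ℕ) : ℤ) - 2 = k by omega,
      show ((k + 2 : ℕ) : ℤ) - 1 = (k + 1 : ℕ) by omega] at h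

theorem lengthGF_auxLang_eq_sum (hm : 1 ≤ m) :
    lengthGF (auxLang m) = ∑ j ∈ Finset.range (m + 1),
      (mu m j : ℕ⟦X⟧) * (X ^ (2 * m + 3)) ^ j * lengthGF (auxLang m) ^ (2 * j) := by
  refine X_pow_mul_cancel (k := m + 1) ?_
  calc X ^ (m + 1) * lengthGF (auxLang m)
      = X * ∑ j ∈ Finset.range (m + 1), (mu m j : ℕ⟦X⟧) * X ^ (m - j) *
          (X * (X ^ (m + 1) * lengthGF (auxLang m))) ^ (2 * j) := by
        rw [← lengthGF_langL_one_eq_auxLang hm, ← sum_antidiagonal_choose_eq_sum_mu,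
          ← lengthGF_descents_natCast, lengthGF_langL_one_eq_descents]
        push_cast
        rfl
    _ = _ := by
        rw [Finset.mul_sum, Finset.mul_sum]
        refine Finset.sum_congr rfl fun j hj => ?_
        obtain ⟨i, rfl⟩ := Nat.exists_eq_add_of_le (Nat.lt_succ_iff.mp (Finset.mem_range.mp hj))
        rw [Nat.add_sub_cancel_left]
        ring

/-- The generating function `∑ u_n t^n` of the theorem. -/
noncomputable def auxGF (m : ℕ) : ℚ⟦X⟧ :=
  mk fun n => (auxCount m n : ℚ)

theorem map_lengthGF_auxLang (m : ℕ) :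
    map (Nat.castRingHom ℚ) (lengthGF (auxLang m)) = expand (2 * m + 3) (by omega) (auxGF m) := by
  ext n
  rw [coeff_map, coeff_lengthGF, coeff_expand]
  split_ifs with h
  · obtain ⟨c, rfl⟩ := h
    rw [Nat.mul_div_cancel_left _ (by omega), auxGF, coeff_mk]
    rfl
  · rw [Set.eq_empty_of_forall_notMem (s := wordsOfLength _ _), Set.ncard_empty, map_zero]
    rintro w ⟨hw, rfl⟩
    exact h (dvd_length_of_val_eq_zero (val_eq_zero_of_mem_auxLang hw))

theorem auxGF_eq_sum (hm : 1 ≤ m) :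
    auxGF m = ∑ j ∈ Finset.range (m + 1), C (mu m j : ℚ) * X ^ j * auxGF m ^ (2 * j) := by
  refine expand_injective (by omega : 2 * m + 3 ≠ 0) ?_
  have hmap := congrArg (map (Nat.castRingHom ℚ)) (lengthGF_auxLang_eq_sum hm)
  simpa only [map_sum, map_mul, map_pow, map_natCast, map_X, expand_X, map_lengthGF_auxLang]
    using hmap

/-- The polynomial `∑ μ_j t^j`, with which the functional equation of `∑ u_n t^n` reads
`V = f(t V^2)`. -/
noncomputable def muPoly (m : ℕ) : Polynomial ℚ :=
  ∑ j ∈ Finset.range (m + 1), Polynomial.C (mu m j : ℚ) * Polynomial.X ^ j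

theorem coeff_muPoly (m j : ℕ) : (muPoly m).coeff j = mu m j := by
  simp only [muPoly, Polynomial.finsetSum_coeff, Polynomial.coeff_C_mul_X_pow, Finset.sum_ite_eq,
    Finset.mem_range]
  split_ifs with h
  · rfl
  · rw [mu, if_neg (by omega), Nat.cast_zero]

theorem aeval_muPoly (m : ℕ) (V : ℚ⟦X⟧) :
    Polynomial.aeval (X * V ^ 2) (muPoly m) =
      ∑ j ∈ Finset.range (m + 1), C (mu m j : ℚ) * X ^ j * V ^ (2 * j) := by
  simp only [muPoly, map_sum, map_mul, map_pow, Polynomial.aeval_C, Polynomial.aeval_X, mul_pow,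
    ← pow_mul, mul_assoc]
  rfl

theorem aeval_muPoly_eq_one_add (m : ℕ) (V : ℚ⟦X⟧) :
    Polynomial.aeval (X * V ^ 2) (muPoly m) =
      1 + ∑ j ∈ Finset.Icc 1 m, C (mu m j : ℚ) * X ^ j * V ^ (2 * j) := by
  have hIcc : Finset.Icc 1 m = Finset.Ico 1 (m + 1) := rfl
  have hmu : mu m 0 = 1 := by simp [mu]
  rw [aeval_muPoly, Finset.range_eq_Ico, Finset.sum_eq_sum_Ico_succ_bot m.succ_pos, hmu, hIcc]
  simp

theorem auxGF_eq_aeval_muPoly (hm : 1 ≤ m) :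
    auxGF m = Polynomial.aeval (X * auxGF m ^ 2) (muPoly m) := by
  rw [aeval_muPoly]
  exact auxGF_eq_sum hm

end GeneratingFunctions

end FactorFree

theorem theorem3p2 (m : ℕ) (hm : 1 ≤ m) :
    (∀ n : ℕ, 1 ≤ n →
      (FactorFree.auxCount m n : ℚ) =
        ∑ k ∈ Finset.Icc 1 n,
          ((2 * n).choose (k - 1) : ℚ) * (((k - 1).factorial : ℚ) / (n.factorial : ℚ)) *
            MvPolynomial.eval (fun j : ℕ => (j.factorial : ℚ) * (FactorFree.mu m j : ℚ))
              (FactorFree.partialBell n k)) ∧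
    (∀ V : PowerSeries ℚ,
      V = 1 + ∑ j ∈ Finset.Icc 1 m,
          PowerSeries.C (FactorFree.mu m j : ℚ) * PowerSeries.X ^ j * V ^ (2 * j) ↔
        V = PowerSeries.mk (fun n : ℕ => (FactorFree.auxCount m n : ℚ))) := by
  have hU := FactorFree.auxGF_eq_aeval_muPoly hm
  refine ⟨fun n hn => ?_, fun V => ?_⟩
  · have hcoeff := FactorFree.coeff_eq_sum_partialBell
      (by simp [FactorFree.coeff_muPoly, FactorFree.mu]) hU (Nat.one_le_iff_ne_zero.mp hn)
    simpa only [FactorFree.coeff_muPoly, FactorFree.auxGF, PowerSeries.coeff_mk] using hcoeff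
  · rw [← FactorFree.aeval_muPoly_eq_one_add]
    exact ⟨fun hV => FactorFree.eq_of_eq_aeval_X_mul_pow hV hU, fun hV => hV ▸ hU⟩
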